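/- Let $$\tilde\omega=2\int_0^1\frac{dx}{\sqrt{1-x^4}},$$ and let $\wp$ be the Weierstrass function with periods $\tilde\omega$ and $\tilde\omega i$, i.e. of the lattice $\tilde\omega\,\mathbb{Z}[i]$. Define the Hurwitz numbers $\tilde H_n$ ($n\ge 2$) by the Laurent expansion of $\wp$ at the origin, $$\wp(z)=\frac1{z^2}+\sum_{n=2}^\infty\frac{2^n\tilde H_n}{n}\,\frac{z^{n-2}}{(n-2)!},$$ and put $$f_1(\tau,t)=\frac{\cosh^2(\tau t/2)}{1-2e^{-t}\cosh(\tau t)+e^{-2t}}.$$ Then for every integer $k\ge1$ the integral below converges absolutely, and $$\tilde H_{2k+2}=\frac{2(k+1)}{4^k\,\tilde\omega^{2k+2}}\left[1+(-1)^{k+1}\right]\int_0^\infty e^{-t}f_1(i,t)\,t^{2k+1}\,dt .$$ -/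

import Mathlib

open scoped Topology Nat

noncomputable section

/-- The real number `ω̃ = 2 ∫₀¹ dx / √(1 - x⁴)`. -/
def lemniscateOmega : ℝ := 2 * ∫ x in (0 : ℝ)..1, 1 / Real.sqrt (1 - x ^ 4)

/-- The (improper) integral defining `ω̃` converges. -/
theorem intervalIntegrable_lemniscateOmega :
    IntervalIntegrable (fun x : ℝ => 1 / Real.sqrt (1 - x ^ 4)) MeasureTheory.volume 0 1 := by
  have h1 : IntervalIntegrable (fun x : ℝ => (1 - x) ^ (-(1 / 2) : ℝ))
      MeasureTheory.volume 0 1 := by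
    have h := (intervalIntegral.intervalIntegrable_rpow' (a := 0) (b := 1)
      (r := (-(1 / 2) : ℝ)) (by norm_num)).comp_sub_left 1
    simpa using h.symm
  refine h1.mono_fun ?_ ?_
  · exact Measurable.aestronglyMeasurable (by fun_prop)
  · rw [Set.uIoc_of_le zero_le_one]
    refine (MeasureTheory.ae_restrict_iff' measurableSet_Ioc).2 (Filter.Eventually.of_forall ?_)
    rintro x ⟨hx0, hx1⟩
    rcases hx1.eq_or_lt with rfl | hx1
    · simp
    have hpos : 0 < 1 - x := by linarith
    have hle : 1 - x ≤ 1 - x ^ 4 := by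
      have : x ^ 4 ≤ x ^ 1 := pow_le_pow_of_le_one hx0.le hx1.le (by norm_num)
      linarith [pow_one x]
    show ‖1 / Real.sqrt (1 - x ^ 4)‖ ≤ ‖(1 - x) ^ (-(1 / 2) : ℝ)‖
    rw [Real.rpow_neg hpos.le, ← Real.sqrt_eq_rpow, ← one_div,
      Real.norm_of_nonneg (by positivity), Real.norm_of_nonneg (by positivity)]
    exact one_div_le_one_div_of_le (Real.sqrt_pos.2 hpos) (Real.sqrt_le_sqrt hle)

theorem lemniscateOmega_pos : 0 < lemniscateOmega := by
  refine mul_pos two_pos (intervalIntegral.intervalIntegral_pos_of_pos_on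
    intervalIntegrable_lemniscateOmega ?_ one_pos)
  rintro x ⟨hx0, hx1⟩
  have : x ^ 4 < 1 := pow_lt_one₀ hx0.le hx1 (by norm_num)
  exact one_div_pos.2 (Real.sqrt_pos.2 (by linarith))

/-- The pair of periods `ω̃`, `ω̃ i`; its lattice is `ω̃ ℤ[i]`. -/
def lemniscatePeriods : PeriodPair where
  ω₁ := (lemniscateOmega : ℂ)
  ω₂ := (lemniscateOmega : ℂ) * Complex.I
  indep := by
    have h0 : lemniscateOmega ≠ 0 := lemniscateOmega_pos.ne'
    rw [LinearIndependent.pair_iff]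
    intro s t h
    have hre := congrArg Complex.re h
    have him := congrArg Complex.im h
    simp [h0] at hre him
    exact ⟨hre, him⟩

/-- The Hurwitz number `H̃ₙ`, for `n ≥ 2`: `2ⁿ H̃ₙ / n · 1 / (n - 2)!` is the coefficient of
`z ^ (n - 2)` in the Laurent expansion at the origin of the Weierstrass function `℘` with periods
`ω̃`, `ω̃ i`. Here `lemniscatePeriods.weierstrassPExcept 0` is the holomorphic extension of
`℘(z) - 1 / z²` to a neighbourhood of the origin. The values at `n = 0, 1` are not meaningful. -/
def hurwitzNumber (n : ℕ) : ℂ :=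
  (n : ℂ) / 2 ^ n * iteratedDeriv (n - 2) (lemniscatePeriods.weierstrassPExcept 0) 0

/-- The expansion `℘(z) = 1 / z² + ∑_{n ≥ 2} 2ⁿ H̃ₙ / n · z ^ (n - 2) / (n - 2)!`
around the origin. -/
theorem weierstrassP_laurent_hurwitzNumber :
    ∀ᶠ z in 𝓝[≠] (0 : ℂ),
      HasSum (fun m : ℕ => 2 ^ (m + 2) * hurwitzNumber (m + 2) / ((m + 2 : ℕ) : ℂ) *
          (z ^ m / (m ! : ℂ)))
        (lemniscatePeriods.weierstrassP z - 1 / z ^ 2) := by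
  have hA := (lemniscatePeriods.analyticAt_weierstrassPExcept 0).hasFPowerSeriesAt
  have h0 := hA.eventually_hasSum
  refine Filter.Eventually.filter_mono nhdsWithin_le_nhds (h0.mono fun z hz => ?_)
  have hdef := lemniscatePeriods.weierstrassPExcept_def (0 : lemniscatePeriods.lattice) z
  simp only [ZeroMemClass.coe_zero] at hdef
  have hval : lemniscatePeriods.weierstrassP z - 1 / z ^ 2
      = lemniscatePeriods.weierstrassPExcept 0 (0 + z) := by
    rw [zero_add, hdef]; simp [sub_eq_add_neg]
  rw [hval]
  refine Eq.mp (congrArg (fun g => HasSum g _) (funext fun m => ?_)) hz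
  symm
  have h2 : ((m : ℂ) + 2) ≠ 0 := by exact_mod_cast (by omega : m + 2 ≠ 0)
  have hf : (m ! : ℂ) ≠ 0 := by exact_mod_cast m.factorial_ne_zero
  simp [hurwitzNumber]
  field_simp

/-- `f₁(τ, t) = cosh²(τ t / 2) / (1 - 2 e^{-t} cosh(τ t) + e^{-2t})`. -/
def eisensteinF₁ (τ : ℂ) (t : ℝ) : ℂ :=
  Complex.cosh (τ * t / 2) ^ 2 /
    (1 - 2 * Complex.exp (-t) * Complex.cosh (τ * t) + Complex.exp (-2 * t))

end

/-!
By Mathlib's power series of `℘` at a lattice point, `hurwitzNumber (m + 2)` is, up to the factor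
`(m + 2) / 2 ^ (m + 2)`, equal to `(m + 1)! * ∑ l ^ (- (m + 2))`, summed over the nonzero points of
the lattice `ω̃ ℤ[i]` (`hurwitzNumber_add_two`). It remains to evaluate the Eisenstein sum of weight
`n = 2 k + 2` over `ℤ[i]`.

Multiplication by `i` permutes `ℤ[i]` and multiplies the summand by `(-1) ^ (k + 1)`, so for even
`k` the sum vanishes, as does the factor `1 + (-1) ^ (k + 1)`. For odd `k` the summand is invariant,
and the sum is four times the sum over the quadrant `|b| ≤ a` in which the two boundary rays count
with weight `1 / 2`. This weighted quadrant is half the sum of four half-open octants, each of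
which is freely parametrised by `ℕ × ℕ` (`tsum_eq_two_mul_tsum_octant`).

All points `l` of these octants have positive real part, so `(n - 1)! / l ^ n` is the Laplace
transform `∫ t ^ (n - 1) * e ^ (- l t)` over the positive half-line. Exchanging sum and integral is
justified by `(p + q + 1) ^ (- n)` being summable over `ℕ × ℕ` for `n ≥ 4`. The sum of `e ^ (- l t)`
over an octant is a product of two geometric series (`hasSum_cexp_octant`), and the four resulting
kernels add up to `4 * e ^ (- t) * f₁(i, t)` (`sum_octantKernel`). The kernels are bounded by
`((1 + t) / t) ^ 2 * e ^ (- t)`, whose pole at `0` is absorbed by `t ^ (2 k + 1)`; this gives the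
absolute convergence.
-/

open MeasureTheory Set Filter

/-! ### The Laplace transform of a power -/

theorem integrableOn_pow_mul_exp_neg_mul (m : ℕ) {r : ℝ} (hr : 0 < r) :
    IntegrableOn (fun t : ℝ => t ^ m * Real.exp (-(r * t))) (Ioi 0) := by
  have h := Real.integral_rpow_mul_exp_neg_mul_Ioi (a := (m : ℝ) + 1) (by positivity) hr
  have h2 : IntegrableOn (fun t : ℝ => t ^ ((m : ℝ) + 1 - 1) * Real.exp (-(r * t))) (Ioi 0) :=
    .of_integral_ne_zero (by rw [h]; positivity)
  simpa using h2

theorem integral_pow_mul_exp_neg_mul (m : ℕ) {r : ℝ} (hr : 0 < r) :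
    ∫ t in Ioi (0 : ℝ), t ^ m * Real.exp (-(r * t)) = m ! * (r ^ (m + 1))⁻¹ := by
  have h := Real.integral_rpow_mul_exp_neg_mul_Ioi (a := (m : ℝ) + 1) (by positivity) hr
  have h1 : ((m : ℝ) + 1) = ((m + 1 : ℕ) : ℝ) := by push_cast; ring
  rw [Real.Gamma_nat_eq_factorial] at h
  simp only [add_sub_cancel_right, Real.rpow_natCast] at h
  rw [h, h1, Real.rpow_natCast]
  simp [mul_comm]

theorem norm_pow_mul_cexp_neg_mul (m : ℕ) (l : ℂ) {t : ℝ} (ht : 0 < t) :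
    ‖(t : ℂ) ^ m * Complex.exp (-(l * t))‖ = t ^ m * Real.exp (-(l.re * t)) := by
  rw [norm_mul, norm_pow, Complex.norm_real, Real.norm_of_nonneg ht.le, Complex.norm_exp]
  simp

theorem integrableOn_pow_mul_cexp_neg_mul (m : ℕ) {l : ℂ} (hl : 0 < l.re) :
    IntegrableOn (fun t : ℝ => (t : ℂ) ^ m * Complex.exp (-(l * t))) (Ioi 0) := by
  refine (integrableOn_pow_mul_exp_neg_mul m hl).mono' (by fun_prop) ?_
  exact (ae_restrict_iff' measurableSet_Ioi).2 <| .of_forall fun t ht =>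
    (norm_pow_mul_cexp_neg_mul m l ht).le

/-- The Laplace transform of `t ^ m` in the open right half-plane. -/
theorem integral_pow_mul_cexp_neg_mul (m : ℕ) {l : ℂ} (hl : 0 < l.re) :
    ∫ t in Ioi (0 : ℝ), (t : ℂ) ^ m * Complex.exp (-(l * t)) = m ! * (l ^ (m + 1))⁻¹ := by
  have hl0 : l ≠ 0 := fun h => by simp [h] at hl
  have hlim (m : ℕ) : Tendsto (fun t : ℝ => (t : ℂ) ^ m * Complex.exp (-(l * t))) atTop (𝓝 0) := by
    rw [tendsto_zero_iff_norm_tendsto_zero]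
    have h := Real.tendsto_pow_mul_exp_neg_atTop_nhds_zero m
    have h2 := (h.comp (tendsto_id.const_mul_atTop hl)).const_mul ((l.re ^ m)⁻¹)
    rw [mul_zero] at h2
    refine h2.congr' ?_
    filter_upwards [eventually_gt_atTop 0] with t ht
    rw [norm_pow_mul_cexp_neg_mul m l ht]
    simp only [Function.comp, id, mul_pow]
    field_simp
  have hexp (t : ℝ) : HasDerivAt (fun t : ℝ => Complex.exp (-(l * t)))
      (Complex.exp (-(l * t)) * (-(l * 1))) t :=
    ((Complex.ofRealCLM.hasDerivAt (x := t)).const_mul l).neg.cexp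
  induction m with
  | zero =>
    have h := integral_Ioi_of_hasDerivAt_of_tendsto' (a := (0 : ℝ))
      (f := fun t : ℝ => -l⁻¹ * Complex.exp (-(l * t)))
      (f' := fun t : ℝ => (t : ℂ) ^ 0 * Complex.exp (-(l * t))) (m := 0)
      (fun t _ => ((hexp t).const_mul (-l⁻¹)).congr_deriv (by field_simp))
      (integrableOn_pow_mul_cexp_neg_mul 0 hl)
      (by simpa using (hlim 0).const_mul (-l⁻¹))
    rw [h]; simp
  | succ m ih =>
    have hi := integrableOn_pow_mul_cexp_neg_mul m hl
    have hi' := integrableOn_pow_mul_cexp_neg_mul (m + 1) hl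
    -- Integration by parts: `- t ^ (m + 1) * e ^ (- l t) / l` is a primitive of the difference of
    -- the new integrand and a multiple of the old one, and vanishes at both ends.
    have h := integral_Ioi_of_hasDerivAt_of_tendsto' (a := (0 : ℝ))
      (f := fun t : ℝ => -l⁻¹ * ((t : ℂ) ^ (m + 1) * Complex.exp (-(l * t))))
      (f' := fun t : ℝ => (t : ℂ) ^ (m + 1) * Complex.exp (-(l * t)) -
        (m + 1) * l⁻¹ * ((t : ℂ) ^ m * Complex.exp (-(l * t)))) (m := 0)
      (fun t _ => ((((Complex.ofRealCLM.hasDerivAt (x := t)).pow (m + 1)).mul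
        (hexp t)).const_mul (-l⁻¹)).congr_deriv (by
          simp only [Complex.ofRealCLM_apply, Complex.ofReal_one]
          push_cast
          field_simp
          simp
          ring))
      (hi'.sub (hi.const_mul _))
      (by simpa using (hlim (m + 1)).const_mul (-l⁻¹))
    rw [integral_sub hi' (hi.const_mul _), integral_const_mul, ih] at h
    rw [sub_eq_iff_eq_add.1 h, Nat.factorial_succ]
    push_cast
    field_simp
    rw [zero_pow m.succ_ne_zero]
    ring

/-! ### Gaussian integers: octants and rotation by `i` -/

theorem tsum_indicator_range {α β : Type*} (F : β → ℂ) {g : α → β} (hg : g.Injective) :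
    ∑' x, (range g).indicator F x = ∑' c, F (g c) := by
  rw [← hg.tsum_eq (f := (range g).indicator F) (by
    intro x hx; by_contra h; exact hx (indicator_of_notMem h F))]
  simp

/-- The points `a + b i` of a half-open octant of the lattice `ℤ[i]`, parametrised by two natural
numbers. For `e = ±1` and `d = 0` this is the octant `0 ≤ e b < a`, and for `d = 1` it is the
octant `0 < e b ≤ a`. -/
def octant (e : ℤ) (d : ℕ) (x : ℕ × ℕ) : ℤ × ℤ := (x.1 + x.2 + 1, e * (x.2 + d))

theorem octant_injective {e : ℤ} (he : e ≠ 0) (d : ℕ) : (octant e d).Injective := by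
  rintro ⟨p, q⟩ ⟨p', q'⟩ h
  simp only [octant, Prod.mk.injEq, mul_right_inj' he] at h
  ext <;> simp <;> omega

theorem mem_range_octant_zero {e : ℤ} (he : e = 1 ∨ e = -1) (x : ℤ × ℤ) :
    x ∈ range (octant e 0) ↔ 0 ≤ e * x.2 ∧ e * x.2 < x.1 := by
  obtain ⟨a, b⟩ := x
  simp only [octant, mem_range, Prod.exists, Prod.mk.injEq]
  constructor
  · rintro ⟨p, q, rfl, rfl⟩
    rcases he with rfl | rfl <;> constructor <;> push_cast <;> linarith
  · rintro ⟨h1, h2⟩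
    refine ⟨(a - 1 - e * b).toNat, (e * b).toNat, ?_⟩
    rcases he with rfl | rfl <;> constructor <;> push_cast <;> omega

theorem mem_range_octant_one {e : ℤ} (he : e = 1 ∨ e = -1) (x : ℤ × ℤ) :
    x ∈ range (octant e 1) ↔ 0 < e * x.2 ∧ e * x.2 ≤ x.1 := by
  obtain ⟨a, b⟩ := x
  simp only [octant, mem_range, Prod.exists, Prod.mk.injEq]
  constructor
  · rintro ⟨p, q, rfl, rfl⟩
    rcases he with rfl | rfl <;> constructor <;> push_cast <;> linarith
  · rintro ⟨h1, h2⟩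
    refine ⟨(a - e * b).toNat, (e * b - 1).toNat, ?_⟩
    rcases he with rfl | rfl <;> constructor <;> push_cast <;> omega

/-- Multiplication by `i` on `ℤ[i]`, in coordinates. -/
def rotate : ℤ × ℤ ≃ ℤ × ℤ where
  toFun x := (-x.2, x.1)
  invFun x := (x.2, -x.1)
  left_inv x := by simp
  right_inv x := by simp

theorem rotate_apply (a b : ℤ) : rotate (a, b) = (-b, a) := rfl

/-- Twice the weight of a lattice point in the closed quadrant `|b| ≤ a` without the origin: an
inner point counts with weight `1` and a point on the boundary with weight `1 / 2`. -/
def quadrantWeight (x : ℤ × ℤ) : ℂ :=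
  (if |x.2| < x.1 then 1 else 0) + (if |x.2| ≤ x.1 ∧ 0 < x.1 then 1 else 0)

/-- The four half-open octants cover the inside of the quadrant `|b| ≤ a` twice and its boundary
once. -/
theorem sum_indicator_octant (F : ℤ × ℤ → ℂ) (x : ℤ × ℤ) :
    (range (octant 1 0)).indicator F x + (range (octant (-1) 0)).indicator F x +
      (range (octant 1 1)).indicator F x + (range (octant (-1) 1)).indicator F x =
    quadrantWeight x * F x := by
  classical
  obtain ⟨a, b⟩ := x
  simp only [indicator_apply, mem_range_octant_zero (Or.inl rfl), mem_range_octant_zero (Or.inr rfl),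
    mem_range_octant_one (Or.inl rfl), mem_range_octant_one (Or.inr rfl), quadrantWeight, abs_lt,
    abs_le]
  split_ifs <;> first | omega | ring

/-- The four rotated copies of the weighted quadrant tile the plane without the origin; the value is
`2` because `quadrantWeight` is twice the weight. -/
theorem sum_quadrantWeight_rotate {x : ℤ × ℤ} (hx : x ≠ 0) :
    quadrantWeight x + quadrantWeight (rotate x) + quadrantWeight (rotate (rotate x)) +
      quadrantWeight (rotate (rotate (rotate x))) = 2 := by
  obtain ⟨a, b⟩ := x
  have h : ¬ (a = 0 ∧ b = 0) := by simpa [Prod.ext_iff] using hx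
  simp only [quadrantWeight, rotate_apply, abs_lt, abs_le]
  split_ifs <;> first | omega | norm_num

/-- A sum over `ℤ[i]` that is invariant under multiplication by `i` is twice the sum over the four
half-open octants in the quadrant `|b| ≤ a`: the plane without the origin consists of four such
quadrants, each covered twice by its octants, except for boundary rays, which two quadrants share. -/
theorem tsum_eq_two_mul_tsum_octant {F : ℤ × ℤ → ℂ} (hF : Summable F) (h0 : F 0 = 0)
    (hrot : ∀ x, F (rotate x) = F x) :
    ∑' x, F x = 2 * (∑' c, F (octant 1 0 c) + ∑' c, F (octant (-1) 0 c) +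
      ∑' c, F (octant 1 1 c) + ∑' c, F (octant (-1) 1 c)) := by
  have h1 : (1 : ℤ) ≠ 0 := one_ne_zero
  have h2 : (-1 : ℤ) ≠ 0 := by norm_num
  have hS (s : Set (ℤ × ℤ)) : Summable (s.indicator F) := hF.indicator s
  have hw : Summable (fun x => quadrantWeight x * F x) :=
    ((((hS _).add (hS _)).add (hS _)).add (hS _)).congr fun x => sum_indicator_octant F x
  have hA : ∑' x, quadrantWeight x * F x = ∑' c, F (octant 1 0 c) + ∑' c, F (octant (-1) 0 c) +
      ∑' c, F (octant 1 1 c) + ∑' c, F (octant (-1) 1 c) := by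
    rw [← tsum_indicator_range F (octant_injective h1 0),
      ← tsum_indicator_range F (octant_injective h2 0),
      ← tsum_indicator_range F (octant_injective h1 1),
      ← tsum_indicator_range F (octant_injective h2 1),
      ← (hS _).tsum_add (hS _), ← ((hS _).add (hS _)).tsum_add (hS _),
      ← (((hS _).add (hS _)).add (hS _)).tsum_add (hS _)]
    exact tsum_congr fun x => (sum_indicator_octant F x).symm
  have hrw {w : ℤ × ℤ → ℂ} (h : Summable (fun x => w x * F x)) :
      Summable (fun x => w (rotate x) * F x) ∧
        ∑' x, w (rotate x) * F x = ∑' x, w x * F x := by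
    have e : (fun x => w (rotate x) * F x) = (fun x => w x * F x) ∘ rotate := by
      funext x; simp [hrot]
    rw [e]
    exact ⟨rotate.summable_iff.2 h, rotate.tsum_eq (fun x => w x * F x)⟩
  obtain ⟨s1, e1⟩ := hrw hw
  obtain ⟨s2, e2⟩ := hrw (w := fun x => quadrantWeight (rotate x)) s1
  obtain ⟨s3, e3⟩ := hrw (w := fun x => quadrantWeight (rotate (rotate x))) s2
  -- Average the quadrant sum over its four rotations.
  have hsum : ∑' x, 2 * F x = 4 * ∑' x, quadrantWeight x * F x := by
    rw [show (4 : ℂ) * ∑' x, quadrantWeight x * F x = ∑' x, quadrantWeight x * F x +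
        ∑' x, quadrantWeight (rotate x) * F x + ∑' x, quadrantWeight (rotate (rotate x)) * F x +
        ∑' x, quadrantWeight (rotate (rotate (rotate x))) * F x by rw [e3, e2, e1]; ring,
      ← hw.tsum_add s1, ← (hw.add s1).tsum_add s2, ← ((hw.add s1).add s2).tsum_add s3]
    refine tsum_congr fun x => ?_
    rcases eq_or_ne x 0 with rfl | hx
    · simp [h0]
    · rw [← sum_quadrantWeight_rotate hx]; ring
  rw [tsum_mul_left, hA] at hsum
  linear_combination hsum / 2

/-! ### The exponential sum over an octant -/

/-- The Gaussian integer `a + b i` as a complex number. -/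
noncomputable def gaussian (x : ℤ × ℤ) : ℂ := x.1 + x.2 * Complex.I

/-- The sum of `e ^ (- l t)` over the lattice points `l` of `octant e d`, in closed form. -/
noncomputable def octantKernel (e : ℤ) (d : ℕ) (t : ℝ) : ℂ :=
  Complex.exp (-t) / (1 - Complex.exp (-t)) *
    (Complex.exp (-(e * t * Complex.I)) ^ d /
      (1 - Complex.exp (-t) * Complex.exp (-(e * t * Complex.I))))

theorem norm_cexp_neg (t : ℝ) : ‖Complex.exp (-t)‖ = Real.exp (-t) := by
  simp [Complex.norm_exp]

theorem norm_cexp_neg_mul_I (e : ℤ) (t : ℝ) : ‖Complex.exp (-(e * t * Complex.I))‖ = 1 := by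
  simp [Complex.norm_exp]

theorem gaussian_octant_re (e : ℤ) (d : ℕ) (c : ℕ × ℕ) :
    (gaussian (octant e d c)).re = c.1 + c.2 + 1 := by
  simp [gaussian, octant]

theorem hasSum_cexp_octant (e : ℤ) (d : ℕ) {t : ℝ} (ht : 0 < t) :
    HasSum (fun c => Complex.exp (-(gaussian (octant e d c) * t))) (octantKernel e d t) := by
  set x := Complex.exp (-t) with hx
  set y := Complex.exp (-(e * t * Complex.I)) with hy
  have hx1 : ‖x‖ < 1 := by rw [norm_cexp_neg]; simpa using ht
  have hxy1 : ‖x * y‖ < 1 := by rw [norm_mul, norm_cexp_neg_mul_I, mul_one]; exact hx1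
  have h := (hasSum_geometric_of_norm_lt_one hx1).mul (hasSum_geometric_of_norm_lt_one hxy1)
    (summable_mul_of_summable_norm (summable_norm_geometric_of_norm_lt_one hx1)
      (summable_norm_geometric_of_norm_lt_one hxy1))
  have h2 := h.mul_left (x * y ^ d)
  have hv : x * y ^ d * ((1 - x)⁻¹ * (1 - x * y)⁻¹) = octantKernel e d t := by
    simp only [octantKernel, ← hx, ← hy, div_eq_mul_inv]; ring
  rw [hv] at h2
  refine h2.congr_fun fun c => ?_
  simp only [hx, hy, ← Complex.exp_nat_mul, ← Complex.exp_add, gaussian, octant]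
  congr 1
  push_cast
  ring

/-- Summability by comparison with a product, as `(p + 1) * (q + 1) ≤ (p + q + 1) ^ 2`. -/
theorem summable_inv_pow_add {n : ℕ} (hn : 4 ≤ n) :
    Summable fun c : ℕ × ℕ => (((c.1 : ℝ) + c.2 + 1) ^ n)⁻¹ := by
  have h : Summable fun n : ℕ => ((((n + 1 : ℕ) : ℝ)) ^ 2)⁻¹ :=
    (summable_nat_add_iff 1).2 (Real.summable_nat_pow_inv.2 one_lt_two)
  refine .of_nonneg_of_le (fun c => by positivity) (fun c => ?_)
    (h.mul_of_nonneg h (fun _ => by positivity) (fun _ => by positivity))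
  rw [← mul_inv, ← mul_pow]
  refine inv_anti₀ (by positivity) ?_
  have h1 : (1 : ℝ) ≤ c.1 + c.2 + 1 := by
    linarith [c.1.cast_nonneg (α := ℝ), c.2.cast_nonneg (α := ℝ)]
  refine le_trans ?_ (pow_le_pow_right₀ h1 hn)
  rw [show 4 = 2 * 2 from rfl, pow_mul]
  push_cast
  gcongr
  nlinarith [c.1.cast_nonneg (α := ℝ), c.2.cast_nonneg (α := ℝ)]

/-- The kernel has at most a double pole at `t = 0` and decays like `e ^ (- t)`. -/
theorem norm_octantKernel_le (e : ℤ) (d : ℕ) {t : ℝ} (ht : 0 < t) :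
    ‖octantKernel e d t‖ ≤ ((1 + t) / t) ^ 2 * Real.exp (-t) := by
  -- Both denominators of the kernel are at least `1 - e ^ (- t)` in absolute value.
  have h1 : t / (1 + t) ≤ 1 - Real.exp (-t) := by
    have h := Real.add_one_le_exp t
    have : Real.exp (-t) ≤ (1 + t)⁻¹ := by
      rw [Real.exp_neg]; exact inv_anti₀ (by positivity) (by linarith)
    have h2 : t / (1 + t) = 1 - (1 + t)⁻¹ := by field_simp; ring
    linarith
  have hpos : 0 < t / (1 + t) := by positivity
  have h2 : t / (1 + t) ≤ ‖1 - Complex.exp (-t)‖ := by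
    refine h1.trans ?_
    simpa [norm_cexp_neg] using norm_sub_norm_le 1 (Complex.exp (-t))
  have h3 : t / (1 + t) ≤ ‖1 - Complex.exp (-t) * Complex.exp (-(e * t * Complex.I))‖ := by
    refine h1.trans ?_
    simpa [norm_cexp_neg, norm_cexp_neg_mul_I] using
      norm_sub_norm_le 1 (Complex.exp (-t) * Complex.exp (-(e * t * Complex.I)))
  rw [octantKernel, norm_mul, norm_div, norm_div, norm_pow, norm_cexp_neg, norm_cexp_neg_mul_I,
    one_pow]
  calc _ ≤ Real.exp (-t) / (t / (1 + t)) * (1 / (t / (1 + t))) := by gcongr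
    _ = _ := by field_simp

theorem integrableOn_pow_mul_octantKernel (e : ℤ) (d : ℕ) (m : ℕ) :
    IntegrableOn (fun t : ℝ => (t : ℂ) ^ (m + 2) * octantKernel e d t) (Ioi 0) := by
  have h (j : ℕ) : IntegrableOn (fun t : ℝ => t ^ j * Real.exp (-t)) (Ioi 0) := by
    simpa using integrableOn_pow_mul_exp_neg_mul j one_pos
  have hb : IntegrableOn (fun t : ℝ => t ^ m * Real.exp (-t) +
      2 * (t ^ (m + 1) * Real.exp (-t)) + t ^ (m + 2) * Real.exp (-t)) (Ioi 0) :=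
    ((h m).add ((h (m + 1)).const_mul 2)).add (h (m + 2))
  refine hb.mono' ?_ ?_
  · refine Measurable.aestronglyMeasurable ?_
    unfold octantKernel
    fun_prop
  · refine (ae_restrict_iff' measurableSet_Ioi).2 (.of_forall fun t ht => ?_)
    have ht : 0 < t := ht
    rw [norm_mul, norm_pow, Complex.norm_real, Real.norm_of_nonneg ht.le]
    refine (mul_le_mul_of_nonneg_left (norm_octantKernel_le e d ht) (by positivity)).trans_eq ?_
    field_simp
    ring

/-- Termwise Laplace transform over one octant. -/
theorem factorial_mul_tsum_octant (e : ℤ) (d : ℕ) {m : ℕ} (hm : 3 ≤ m) :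
    m ! * ∑' c, (gaussian (octant e d c) ^ (m + 1))⁻¹ =
      ∫ t in Ioi (0 : ℝ), (t : ℂ) ^ m * octantKernel e d t := by
  have hre (c : ℕ × ℕ) : 0 < (gaussian (octant e d c)).re := by
    rw [gaussian_octant_re]; positivity
  have h := hasSum_integral_of_summable_integral_norm (μ := volume.restrict (Ioi (0 : ℝ)))
    (F := fun c (t : ℝ) => (t : ℂ) ^ m * Complex.exp (-(gaussian (octant e d c) * t)))
    (fun c => integrableOn_pow_mul_cexp_neg_mul m (hre c)) (by
      refine ((summable_inv_pow_add (n := m + 1) (by omega)).mul_left (m ! : ℝ)).congr fun c => ?_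
      rw [setIntegral_congr_fun measurableSet_Ioi
        (fun t ht => norm_pow_mul_cexp_neg_mul m (gaussian (octant e d c)) ht),
        integral_pow_mul_exp_neg_mul m (hre c), gaussian_octant_re])
  simp only [fun c => integral_pow_mul_cexp_neg_mul m (hre c)] at h
  rw [← tsum_mul_left, h.tsum_eq]
  refine setIntegral_congr_fun measurableSet_Ioi fun t ht => ?_
  rw [tsum_mul_left, (hasSum_cexp_octant e d ht).tsum_eq]

/-- The kernels of the four octants add up to the kernel of the integral formula. -/
theorem sum_octantKernel {t : ℝ} (ht : 0 < t) :
    octantKernel 1 0 t + octantKernel (-1) 0 t + octantKernel 1 1 t + octantKernel (-1) 1 t =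
      4 * (Complex.exp (-t) * eisensteinF₁ Complex.I t) := by
  have hcosh : Complex.cosh (Complex.I * t / 2) ^ 2 = (Complex.cosh (Complex.I * t) + 1) / 2 := by
    have h := Complex.cosh_two_mul (Complex.I * t / 2)
    rw [Complex.sinh_sq, show 2 * (Complex.I * t / 2) = Complex.I * t by ring] at h
    rw [h]; ring
  have hx2 : Complex.exp (-2 * t) = Complex.exp (-t) ^ 2 := by
    rw [← Complex.exp_nat_mul]; congr 1; push_cast; ring
  have hd (z : ℂ) (hz : ‖z‖ < 1) : 1 - z ≠ 0 := fun h => by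
    rw [← sub_eq_zero.1 h] at hz; simp at hz
  have hlt : Real.exp (-t) < 1 := by simpa using ht
  have hd0 := hd (Complex.exp (-t)) (by rwa [norm_cexp_neg])
  have hd1 := hd (Complex.exp (-t) * Complex.exp (-((1 : ℤ) * t * Complex.I)))
    (by rwa [norm_mul, norm_cexp_neg, norm_cexp_neg_mul_I, mul_one])
  have hd2 := hd (Complex.exp (-t) * Complex.exp (-((-1 : ℤ) * t * Complex.I)))
    (by rwa [norm_mul, norm_cexp_neg, norm_cexp_neg_mul_I, mul_one])
  have huv : Complex.exp (-((1 : ℤ) * t * Complex.I)) *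
      Complex.exp (-((-1 : ℤ) * t * Complex.I)) = 1 := by
    rw [← Complex.exp_add]; simp
  have hc : Complex.cosh (Complex.I * t) = (Complex.exp (-((1 : ℤ) * t * Complex.I)) +
      Complex.exp (-((-1 : ℤ) * t * Complex.I))) / 2 := by
    rw [Complex.cosh, add_comm]; congr 3 <;> · push_cast; ring
  simp only [octantKernel, eisensteinF₁, hcosh, hx2, hc]
  generalize Complex.exp (-((1 : ℤ) * t * Complex.I)) = u at *
  generalize Complex.exp (-((-1 : ℤ) * t * Complex.I)) = v at *
  generalize Complex.exp (-t) = x at *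
  -- With `u = e ^ (- i t)`, `v = e ^ (i t)` and `x = e ^ (- t)`, the denominator factors as `u v = 1`.
  have hden : 1 - 2 * x * ((u + v) / 2) + x ^ 2 = (1 - x * u) * (1 - x * v) := by
    linear_combination (-x ^ 2) * huv
  rw [hden]
  field_simp
  linear_combination (-8 * x ^ 2) * huv

/-! ### Hurwitz numbers as sums over `ℤ[i]` -/

theorem lattice_latticeEquivProd_symm (x : ℤ × ℤ) :
    (lemniscatePeriods.latticeEquivProd.symm x).1 = lemniscateOmega * gaussian x := by
  rw [PeriodPair.latticeEquiv_symm_apply]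
  simp only [lemniscatePeriods, gaussian]
  ring

theorem summable_inv_gaussian_pow {n : ℕ} (hn : 2 < n) :
    Summable fun x => (gaussian x ^ n)⁻¹ := by
  have h := (lemniscatePeriods.hasSum_sumInvPow 0 hn).summable
  have h2 := (lemniscatePeriods.latticeEquivProd.symm.toEquiv.summable_iff.2 h).mul_left
    ((lemniscateOmega : ℂ) ^ n)
  refine h2.congr fun x => ?_
  have h0 : (lemniscateOmega : ℂ) ≠ 0 := by exact_mod_cast lemniscateOmega_pos.ne'
  simp only [Function.comp, LinearEquiv.coe_toEquiv, lattice_latticeEquivProd_symm, sub_zero,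
    mul_pow]
  field_simp

theorem sumInvPow_lemniscatePeriods (n : ℕ) :
    lemniscatePeriods.sumInvPow 0 n =
      ((lemniscateOmega : ℂ) ^ n)⁻¹ * ∑' x, (gaussian x ^ n)⁻¹ := by
  rw [PeriodPair.sumInvPow, ← tsum_mul_left,
    ← lemniscatePeriods.latticeEquivProd.symm.toEquiv.tsum_eq]
  refine tsum_congr fun x => ?_
  simp [lattice_latticeEquivProd_symm, mul_pow, mul_comm]

/-- The Hurwitz number as an Eisenstein sum. The case `m = 0` is excluded: there the constant term of
`℘(z) - 1 / z ^ 2` is `0`, and the sum of weight `2` does not converge absolutely. The origin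
contributes `0⁻¹ = 0` to the sum. -/
theorem hurwitzNumber_add_two {m : ℕ} (hm : m ≠ 0) :
    hurwitzNumber (m + 2) = (m + 2) / 2 ^ (m + 2) * ((m + 1)! *
      (((lemniscateOmega : ℂ) ^ (m + 2))⁻¹ * ∑' x, (gaussian x ^ (m + 2))⁻¹)) := by
  rw [hurwitzNumber, Nat.add_sub_cancel, PeriodPair.iteratedDeriv_weierstrassPExcept_self,
    if_neg hm, sumInvPow_lemniscatePeriods]
  push_cast
  rfl

theorem gaussian_rotate (x : ℤ × ℤ) : gaussian (rotate x) = Complex.I * gaussian x := by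
  obtain ⟨a, b⟩ := x
  simp only [gaussian, rotate_apply]
  push_cast
  linear_combination (-(b : ℂ)) * Complex.I_mul_I

theorem theorem14 (k : ℕ) (hk : 1 ≤ k) :
    MeasureTheory.IntegrableOn
      (fun t : ℝ => Complex.exp (-t) * eisensteinF₁ Complex.I t * (t : ℂ) ^ (2 * k + 1))
      (Set.Ioi 0) ∧
    hurwitzNumber (2 * k + 2) =
      2 * ((k : ℂ) + 1) / (4 ^ k * (lemniscateOmega : ℂ) ^ (2 * k + 2)) *
        (1 + (-1) ^ (k + 1)) *
        ∫ t in Set.Ioi (0 : ℝ),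
          Complex.exp (-t) * eisensteinF₁ Complex.I t * (t : ℂ) ^ (2 * k + 1) := by
  have hi (e : ℤ) (d : ℕ) : IntegrableOn (fun t : ℝ => (t : ℂ) ^ (2 * k + 1) * octantKernel e d t)
      (Ioi 0) := by
    simpa only [show 2 * k - 1 + 2 = 2 * k + 1 by omega] using
      integrableOn_pow_mul_octantKernel e d (2 * k - 1)
  have hker : ∀ t ∈ Ioi (0 : ℝ), (t : ℂ) ^ (2 * k + 1) * octantKernel 1 0 t +
      (t : ℂ) ^ (2 * k + 1) * octantKernel (-1) 0 t +
      (t : ℂ) ^ (2 * k + 1) * octantKernel 1 1 t + (t : ℂ) ^ (2 * k + 1) * octantKernel (-1) 1 t =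
      4 * (Complex.exp (-t) * eisensteinF₁ Complex.I t * (t : ℂ) ^ (2 * k + 1)) := fun t ht => by
    linear_combination (t : ℂ) ^ (2 * k + 1) * sum_octantKernel ht
  have hsum := (((hi 1 0).add (hi (-1) 0)).add (hi 1 1)).add (hi (-1) 1)
  refine ⟨?_, ?_⟩
  · have h := ((integrableOn_congr_fun hker measurableSet_Ioi).1 hsum).const_mul (1 / 4 : ℂ)
    refine IntegrableOn.congr_fun h (fun t _ => ?_) measurableSet_Ioi
    ring
  have hgauss : gaussian 0 = 0 := by simp [gaussian]
  have hpow : Complex.I ^ (2 * k + 2) = (-1) ^ (k + 1) := by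
    rw [show 2 * k + 2 = 2 * (k + 1) by ring, pow_mul, Complex.I_sq]
  have h0 : (lemniscateOmega : ℂ) ≠ 0 := by exact_mod_cast lemniscateOmega_pos.ne'
  rw [hurwitzNumber_add_two (by omega)]
  rcases Nat.even_or_odd (k + 1) with hev | hodd
  · rw [hev.neg_one_pow] at hpow ⊢
    have hrot (x : ℤ × ℤ) :
        (gaussian (rotate x) ^ (2 * k + 2))⁻¹ = (gaussian x ^ (2 * k + 2))⁻¹ := by
      rw [gaussian_rotate, mul_pow, hpow, one_mul]
    have hint := setIntegral_congr_fun measurableSet_Ioi hker (μ := volume)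
    rw [integral_const_mul,
      integral_add (f := fun t : ℝ => (t : ℂ) ^ (2 * k + 1) * octantKernel 1 0 t +
        (t : ℂ) ^ (2 * k + 1) * octantKernel (-1) 0 t + (t : ℂ) ^ (2 * k + 1) * octantKernel 1 1 t)
        (((hi 1 0).add (hi (-1) 0)).add (hi 1 1)) (hi (-1) 1),
      integral_add (f := fun t : ℝ => (t : ℂ) ^ (2 * k + 1) * octantKernel 1 0 t +
        (t : ℂ) ^ (2 * k + 1) * octantKernel (-1) 0 t) ((hi 1 0).add (hi (-1) 0)) (hi 1 1),
      integral_add (hi 1 0) (hi (-1) 0),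
      ← factorial_mul_tsum_octant 1 0 (by omega), ← factorial_mul_tsum_octant (-1) 0 (by omega),
      ← factorial_mul_tsum_octant 1 1 (by omega),
      ← factorial_mul_tsum_octant (-1) 1 (by omega)] at hint
    have hG := tsum_eq_two_mul_tsum_octant (summable_inv_gaussian_pow (n := 2 * k + 2) (by omega))
      (by simp [hgauss]) hrot
    have hG' : ((2 * k + 1)! : ℂ) * ∑' x, (gaussian x ^ (2 * k + 2))⁻¹ =
        8 * ∫ t in Set.Ioi (0 : ℝ),
          Complex.exp (-t) * eisensteinF₁ Complex.I t * (t : ℂ) ^ (2 * k + 1) := by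
      rw [hG]
      linear_combination 2 * hint
    rw [mul_left_comm _ (_ ⁻¹), hG', show (2 : ℂ) ^ (2 * k + 2) = 4 ^ k * 4 by
      rw [pow_add, pow_mul]; norm_num]
    push_cast
    field_simp
    ring
  · rw [hodd.neg_one_pow] at hpow ⊢
    -- Rotation by `i` changes the sign of every summand, so the sum is its own negative.
    have hz : ∑' x, (gaussian x ^ (2 * k + 2))⁻¹ = 0 := by
      rw [← CharZero.eq_neg_self_iff, ← tsum_neg, ← rotate.tsum_eq]
      refine tsum_congr fun x => ?_
      rw [gaussian_rotate, mul_pow, hpow, neg_one_mul, inv_neg]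
    rw [hz]
    simp
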